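/- Let $(X_n)_{n\ge 1}$ be a strictly stationary sequence of real random variables on a probability space $(\Omega,\mathcal F,\mathbb P)$, let $\lambda\in(0,1)$, and let $(k_n)_{n\ge1}$ be a sequence of integers with $1\le k_n\le n$ for all $n\ge 1$ and $k_n/n\to\lambda$. Let $X_{1:n}\le\dots\le X_{n:n}$ denote the order statistics of $X_1,\dots,X_n$. Let $\mathcal I^{\mathbb X}$ be the $\sigma$-field of all $A\in\mathcal F$ for which there is a Borel set $B\subseteq\mathbb R^{\mathbb N}$ such that $A=\{\omega:(X_i(\omega),X_{i+1}(\omega),\dots)\in B\}$ for every $i\ge1$. A version of the conditional $\lambda$th quantile $\pi_\lambda(X_1\mid\mathcal I^{\mathbb X})$ is an $\mathcal I^{\mathbb X}$-measurable random variable $Q$ with $\mathbb P(X_1\ge Q\mid\mathcal I^{\mathbb X})\ge 1-\lambda$ and $\mathbb P(X_1\le Q\mid\mathcal I^{\mathbb X})\ge\lambda$ almost surely; it is called unique if any two versions are almost surely equal. If $\pi_\lambda(X_1\mid\mathcal I^{\mathbb X})$ is unique, then $X_{k_n:n}\to\pi_\lambda(X_1\mid\mathcal I^{\mathbb X})$ $\mathbb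 P$-almost surely as $n\to\infty$; that is, a version of $\pi_\lambda(X_1\mid\mathcal I^{\mathbb X})$ exists, and $X_{k_n:n}\to Q$ almost surely for every version $Q$. -/

import Mathlib

open MeasureTheory ProbabilityTheory Filter Topology

/-- A sequence `X_1, X_2, …` of random variables is indexed from `0` here: `X i` is `X_{i+1}`, and
`X 0` is `X_1`. The sequence is strictly stationary if, for every shift `m`, the shifted
sequence has the same law on `ℝ^ℕ` as the sequence itself. It is meant for sequences of
measurable functions and a probability measure `μ`. -/
def StrictlyStationary {Ω : Type*} [MeasurableSpace Ω] (X : ℕ → Ω → ℝ) (μ : Measure Ω) : Prop :=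
  ∀ m : ℕ, μ.map (fun ω (j : ℕ) => X (m + j) ω) = μ.map (fun ω (j : ℕ) => X j ω)

/-- The sigma-field of all events `A` that are invariant with respect to the sequence `X`: there
is one Borel set `B` of `ℝ^ℕ` such that `A = {ω | (X_i ω, X_{i+1} ω, …) ∈ B}` for every `i`. -/
@[reducible]
def invariantSigmaField {Ω : Type*} [MeasurableSpace Ω] (X : ℕ → Ω → ℝ) : MeasurableSpace Ω where
  MeasurableSet' A := MeasurableSet A ∧
    ∃ B : Set (ℕ → ℝ), MeasurableSet B ∧ ∀ i : ℕ, A = {ω | (fun j => X (i + j) ω) ∈ B}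
  measurableSet_empty := ⟨MeasurableSet.empty, ∅, MeasurableSet.empty, fun _ => rfl⟩
  measurableSet_compl := by
    rintro A ⟨hA, B, hB, h⟩
    refine ⟨hA.compl, Bᶜ, hB.compl, fun i => ?_⟩
    rw [h i]
    rfl
  measurableSet_iUnion := by
    intro A hA
    choose hm B hB h using hA
    refine ⟨MeasurableSet.iUnion hm, ⋃ n, B n, MeasurableSet.iUnion hB, fun i => ?_⟩
    ext ω
    simp only [Set.mem_iUnion, Set.mem_ofPred_eq]
    refine exists_congr fun n => ?_
    rw [h n i]
    rfl

theorem invariantSigmaField_le {Ω : Type*} [mΩ : MeasurableSpace Ω] (X : ℕ → Ω → ℝ) :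
    invariantSigmaField X ≤ mΩ :=
  fun _ h => h.1

/-- `Q` is (a version of) the conditional `p`-th quantile of `Y` with respect to the sigma-field
`G`, which is meant to be a sub-sigma-field of the ambient one. Here `μ⟦A|G⟧` is Mathlib's
conditional probability of the event `A` given `G`. -/
structure IsCondQuantile {Ω : Type*} (G : MeasurableSpace Ω) [mΩ : MeasurableSpace Ω]
    (μ : Measure Ω) (Y : Ω → ℝ) (p : ℝ) (Q : Ω → ℝ) : Prop where
  measurable : Measurable[G] Q
  le_prob_ge : ∀ᵐ ω ∂μ, 1 - p ≤ (μ⟦{ω' | Q ω' ≤ Y ω'}|G⟧) ω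
  le_prob_le : ∀ᵐ ω ∂μ, p ≤ (μ⟦{ω' | Y ω' ≤ Q ω'}|G⟧) ω

/-- Any two versions of the conditional `p`-th quantile are almost surely equal. -/
def CondQuantileUnique {Ω : Type*} (G : MeasurableSpace Ω) [mΩ : MeasurableSpace Ω]
    (μ : Measure Ω) (Y : Ω → ℝ) (p : ℝ) : Prop :=
  ∀ Q Q' : Ω → ℝ, IsCondQuantile G μ Y p Q → IsCondQuantile G μ Y p Q' → Q =ᵐ[μ] Q'

/-- The order statistic `x_{k:n}`: the `k`-th smallest (`1 ≤ k ≤ n`, counted with multiplicity)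
of the first `n` terms `x 0, …, x (n - 1)`. The value is `0` outside the range `1 ≤ k ≤ n`. -/
noncomputable def orderStat (x : ℕ → ℝ) (k n : ℕ) : ℝ :=
  if h : 1 ≤ k ∧ k ≤ n then
    x (Tuple.sort (fun i : Fin n => x i) ⟨k - 1, by omega⟩ : Fin n)
  else 0

/-! At most `t` is the `k`-th order statistic exactly when at least `k` of the first `n` terms are,
so `k n / n → p` has to be compared with empirical frequencies. By Birkhoff's theorem on sequence
space these converge almost surely to the conditional distribution function `F` given the invariant
events, for all rational `t` at once (`StrictlyStationary.ae_tendsto_frequency`).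

The smallest and the largest `p`-quantile of `F` are both versions of the conditional quantile
(`isCondQuantile_of_cdf`), which gives existence. Under uniqueness every version `Q` equals both
almost surely, so `F < p` below `Q` and `F > p` above it, and the order statistics are squeezed to
`Q` (`tendsto_orderStat`). -/

section Ergodic

/-! ### Maximal inequality and Birkhoff's pointwise ergodic theorem -/

variable {Y : Type*} {T : Y → Y}

/-- The running maximum `max (0, S_1 g, …, S_n g)` of the Birkhoff sums of `g`. -/
noncomputable def birkhoffMax (T : Y → Y) (g : Y → ℝ) : ℕ → Y → ℝ
  | 0 => fun _ => 0
  | n + 1 => fun y => max 0 (g y + birkhoffMax T g n (T y))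

theorem birkhoffMax_nonneg (g : Y → ℝ) (n : ℕ) (y : Y) : 0 ≤ birkhoffMax T g n y := by
  cases n
  · exact le_rfl
  · exact le_max_left _ _

theorem birkhoffMax_le_succ (g : Y → ℝ) (n : ℕ) (y : Y) :
    birkhoffMax T g n y ≤ birkhoffMax T g (n + 1) y := by
  induction n generalizing y with
  | zero => exact birkhoffMax_nonneg g 1 y
  | succ n ih =>
    have := ih (T y)
    simp only [birkhoffMax] at this ⊢
    gcongr

theorem birkhoffSum_le_birkhoffMax (g : Y → ℝ) (n : ℕ) (y : Y) :
    birkhoffSum T g n y ≤ birkhoffMax T g n y := by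
  induction n generalizing y with
  | zero => simp [birkhoffMax]
  | succ n ih =>
    rw [birkhoffSum_succ']
    exact (add_le_add_right (ih (T y)) _).trans (le_max_right _ _)

variable [MeasurableSpace Y] {ν : Measure Y}

theorem MeasureTheory.MeasurePreserving.integrable_birkhoffMax (hT : MeasurePreserving T ν ν)
    {g : Y → ℝ} (hg : Integrable g ν) (n : ℕ) : Integrable (birkhoffMax T g n) ν := by
  induction n with
  | zero => exact integrable_zero _ _ _
  | succ n ih =>
    exact (integrable_zero _ _ _).sup (hg.add (hT.integrable_comp_of_integrable ih))

theorem measurable_birkhoffMax (hT : Measurable T) {g : Y → ℝ} (hg : Measurable g) (n : ℕ) :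
    Measurable (birkhoffMax T g n) := by
  induction n with
  | zero => exact measurable_const
  | succ n ih => exact measurable_const.max (hg.add (ih.comp hT))

/-- The maximal ergodic theorem, for a function whose Birkhoff sums almost surely become positive. -/
theorem MeasureTheory.MeasurePreserving.integral_nonneg_of_birkhoffSum_pos
    (hT : MeasurePreserving T ν ν) {g : Y → ℝ} (hgm : Measurable g) (hg : Integrable g ν)
    (hpos : ∀ᵐ y ∂ν, ∃ n, 0 < birkhoffSum T g n y) : 0 ≤ ∫ y, g y ∂ν := by
  set E : ℕ → Set Y := fun n => {y | 0 < birkhoffMax T g (n + 1) y}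
  have hE : ∀ n, MeasurableSet (E n) := fun n =>
    measurableSet_lt measurable_const (measurable_birkhoffMax hT.measurable hgm _)
  have hlim : Tendsto (fun n => ∫ y, (E n).indicator g y ∂ν) atTop (𝓝 (∫ y, g y ∂ν)) := by
    refine tendsto_integral_of_dominated_convergence (fun y => ‖g y‖)
      (fun n => (hg.indicator (hE n)).aestronglyMeasurable) hg.norm
      (fun n => Eventually.of_forall fun y => norm_indicator_le_norm_self _ _) ?_
    filter_upwards [hpos] with y ⟨n, hn⟩
    refine tendsto_const_nhds.congr' ?_
    filter_upwards [eventually_ge_atTop n] with m hm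
    have hmono : Monotone fun k => birkhoffMax T g k y :=
      monotone_nat_of_le_succ fun k => birkhoffMax_le_succ g k y
    have : y ∈ E m :=
      hn.trans_le ((birkhoffSum_le_birkhoffMax g n y).trans (hmono (hm.trans m.le_succ)))
    rw [Set.indicator_of_mem this]
  refine ge_of_tendsto' hlim fun n => ?_
  -- On `E n` the outer maximum is inactive and this is an equality; off `E n` the left side is at
  -- most `0`. By invariance the integral of the left side is that of an increment of the running
  -- maximum.
  have hpt : ∀ y, birkhoffMax T g (n + 1) y - birkhoffMax T g n (T y) ≤ (E n).indicator g y := by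
    intro y
    by_cases hy : y ∈ E n
    · rw [Set.indicator_of_mem hy]
      have h : 0 < max 0 (g y + birkhoffMax T g n (T y)) := hy
      have h' : 0 < g y + birkhoffMax T g n (T y) := by simpa using h
      simp only [birkhoffMax, max_eq_right h'.le]
      linarith
    · rw [Set.indicator_of_notMem hy]
      have h : birkhoffMax T g (n + 1) y ≤ 0 := not_lt.1 hy
      have := birkhoffMax_nonneg (T := T) g n (T y)
      linarith
  have hi := hT.integrable_birkhoffMax hg
  calc (0 : ℝ) ≤ (∫ y, birkhoffMax T g (n + 1) y ∂ν) - ∫ y, birkhoffMax T g n y ∂ν :=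
        sub_nonneg.2 (integral_mono (hi n) (hi (n + 1)) (birkhoffMax_le_succ g n))
    _ = (∫ y, birkhoffMax T g (n + 1) y ∂ν) - ∫ y, birkhoffMax T g n (T y) ∂ν := by
        congr 1
        conv_lhs => rw [← hT.map_eq]
        refine integral_map hT.measurable.aemeasurable ?_
        rw [hT.map_eq]
        exact (hi n).aestronglyMeasurable
    _ = ∫ y, (birkhoffMax T g (n + 1) y - birkhoffMax T g n (T y)) ∂ν :=
        (integral_sub (hi (n + 1)) (hT.integrable_comp_of_integrable (hi n))).symm
    _ ≤ ∫ y, (E n).indicator g y ∂ν :=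
        integral_mono ((hi (n + 1)).sub (hT.integrable_comp_of_integrable (hi n)))
          (hg.indicator (hE n)) hpt

/-- If the conditional expectation of `g` given the invariant events is at most `-ε < 0`, then the
Birkhoff sums of `g` are almost surely bounded above. -/
theorem MeasureTheory.MeasurePreserving.ae_bddAbove_birkhoffSum [IsFiniteMeasure ν]
    (hT : MeasurePreserving T ν ν) {g : Y → ℝ} (hgm : Measurable g) (hg : Integrable g ν)
    {ε : ℝ} (hε : 0 < ε)
    (h : ∀ A, MeasurableSet A → T ⁻¹' A = A → ∫ y in A, g y ∂ν ≤ - ε * ν.real A) :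
    ∀ᵐ y ∂ν, BddAbove (Set.range fun n => birkhoffSum T g n y) := by
  have hSm : ∀ n, Measurable (birkhoffSum T g n) := fun n => by
    unfold birkhoffSum
    exact Finset.measurable_sum _ fun k _ => hgm.comp (hT.measurable.iterate k)
  -- The bad set is strictly invariant, so the maximal theorem applies to the restriction of `ν` to
  -- it: `0 ≤ ∫_B g ≤ -ε ν(B)` forces `ν(B) = 0`.
  set B : Set Y := {y | BddAbove (Set.range fun n => birkhoffSum T g n y)}ᶜ
  have hB : MeasurableSet B := (measurableSet_bddAbove_range hSm).compl
  have hTB : T ⁻¹' B = B := by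
    rw [Set.preimage_compl]
    congr 1
    ext y
    constructor
    · rintro ⟨C, hC⟩
      refine ⟨max 0 (g y + C), ?_⟩
      rintro _ ⟨n, rfl⟩
      cases n with
      | zero => simp
      | succ n =>
        simp only [birkhoffSum_succ']
        exact (add_le_add_right (hC ⟨n, rfl⟩) _).trans (le_max_right _ _)
    · rintro ⟨C, hC⟩
      refine ⟨C - g y, ?_⟩
      rintro _ ⟨n, rfl⟩
      have := hC ⟨n + 1, rfl⟩
      simp only [birkhoffSum_succ'] at this ⊢
      linarith
  have hTr : MeasurePreserving T (ν.restrict B) (ν.restrict B) := by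
    have := hT.restrict_preimage hB
    rwa [hTB] at this
  have hnn : 0 ≤ ∫ y in B, g y ∂ν := by
    refine hTr.integral_nonneg_of_birkhoffSum_pos hgm hg.integrableOn ?_
    filter_upwards [ae_restrict_mem hB] with y hy
    by_contra! hcon
    exact hy ⟨0, by rintro _ ⟨n, rfl⟩; exact hcon n⟩
  have hle := h B hB hTB
  have h0 : ν.real B = 0 := le_antisymm (by nlinarith) measureReal_nonneg
  rwa [measureReal_eq_zero_iff] at h0

/-- The sums of `φ - H - ε/2` are bounded above by some `C`; since `H` is invariant, dividing by `n`
leaves an error `C / n`, eventually below the other `ε/2`. -/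
theorem MeasureTheory.MeasurePreserving.ae_eventually_birkhoffSum_div_lt [IsFiniteMeasure ν]
    (hT : MeasurePreserving T ν ν) {φ H : Y → ℝ} (hφm : Measurable φ) (hφ : Integrable φ ν)
    (hHm : Measurable H) (hH : Integrable H ν) (hHT : H ∘ T = H)
    (h : ∀ A, MeasurableSet A → T ⁻¹' A = A → ∫ y in A, φ y ∂ν = ∫ y in A, H y ∂ν)
    {ε : ℝ} (hε : 0 < ε) :
    ∀ᵐ y ∂ν, ∀ᶠ n : ℕ in atTop, birkhoffSum T φ n y / n < H y + ε := by
  have hg : Integrable (φ - (H + fun _ => ε / 2)) ν :=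
    hφ.sub (hH.add (integrable_const _))
  have hgm : Measurable (φ - (H + fun _ => ε / 2)) := hφm.sub (hHm.add measurable_const)
  have hbdd := hT.ae_bddAbove_birkhoffSum hgm hg (half_pos hε) fun A hA hTA => by
    rw [integral_sub' hφ.integrableOn (hH.add (integrable_const _)).integrableOn,
      integral_add' hH.integrableOn (integrable_const _).integrableOn, h A hA hTA]
    simp [mul_comm]
  filter_upwards [hbdd] with y ⟨C, hC⟩
  have hlim : Tendsto (fun n : ℕ => C / n) atTop (𝓝 0) :=
    tendsto_const_div_atTop_nhds_zero_nat C
  filter_upwards [hlim.eventually_lt_const (half_pos hε), eventually_gt_atTop 0] with n hn hn0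
  have hn0' : (0 : ℝ) < n := by exact_mod_cast hn0
  have h1 : birkhoffSum T (φ - (H + fun _ => ε / 2)) n y ≤ C := hC ⟨n, rfl⟩
  have hinv : (H + fun _ => ε / 2) ∘ T = H + fun _ => ε / 2 := by
    ext z
    simpa using congrFun hHT z
  rw [birkhoffSum_sub, birkhoffSum_of_comp_eq hinv] at h1
  simp only [Pi.smul_apply, Pi.add_apply, nsmul_eq_mul] at h1
  rw [div_lt_iff₀ hn0'] at hn ⊢
  nlinarith

/-- Birkhoff's pointwise ergodic theorem. -/
theorem MeasureTheory.MeasurePreserving.ae_tendsto_birkhoffSum_div [IsFiniteMeasure ν]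
    (hT : MeasurePreserving T ν ν) {φ H : Y → ℝ} (hφm : Measurable φ) (hφ : Integrable φ ν)
    (hHm : Measurable H) (hH : Integrable H ν) (hHT : H ∘ T = H)
    (h : ∀ A, MeasurableSet A → T ⁻¹' A = A → ∫ y in A, φ y ∂ν = ∫ y in A, H y ∂ν) :
    ∀ᵐ y ∂ν, Tendsto (fun n : ℕ => birkhoffSum T φ n y / n) atTop (𝓝 (H y)) := by
  have hpos : ∀ m : ℕ, (0 : ℝ) < 1 / (m + 1) := fun m => Nat.one_div_pos_of_nat
  have hup := ae_all_iff.2 fun m : ℕ =>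
    hT.ae_eventually_birkhoffSum_div_lt hφm hφ hHm hH hHT h (hpos m)
  have hlow := ae_all_iff.2 fun m : ℕ =>
    hT.ae_eventually_birkhoffSum_div_lt hφm.neg hφ.neg hHm.neg hH.neg
      (by ext z; simpa using congrFun hHT z)
      (fun A hA hTA => by simp [integral_neg, h A hA hTA]) (hpos m)
  filter_upwards [hup, hlow] with y hyu hyl
  rw [tendsto_order]
  constructor
  · intro a ha
    obtain ⟨m, hm⟩ := exists_nat_one_div_lt (sub_pos.2 ha)
    filter_upwards [hyl m] with n hn
    rw [birkhoffSum_neg, neg_div, Pi.neg_apply] at hn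
    linarith
  · intro a ha
    obtain ⟨m, hm⟩ := exists_nat_one_div_lt (sub_pos.2 ha)
    filter_upwards [hyu m] with n hn
    linarith

end Ergodic

/-! ### Order statistics and counting -/

/-- The order statistic `x_{k:n}` is at most `t` iff at least `k` of the first `n` terms are. -/
theorem orderStat_le_iff (x : ℕ → ℝ) {k n : ℕ} (hk : 1 ≤ k ∧ k ≤ n) (t : ℝ) :
    orderStat x k n ≤ t ↔ k ≤ Finset.card {i ∈ Finset.range n | x i ≤ t} := by
  set f : Fin n → ℝ := fun i => x i
  have h1 := Tuple.lt_card_le_iff_apply_le_of_monotone (f := f ∘ Tuple.sort f) (a := t)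
    (j := ⟨k - 1, by omega⟩) (Tuple.monotone_sort f)
  have hcard : Finset.card {i : Fin n | (f ∘ Tuple.sort f) i ≤ t}
      = Finset.card {i ∈ Finset.range n | x i ≤ t} := by
    refine Finset.card_bij (fun i _ => (Tuple.sort f i : ℕ)) ?_ ?_ ?_
    · intro i hi
      simpa [f] using hi
    · intro i _ j _ hij
      exact (Tuple.sort f).injective (Fin.ext hij)
    · intro b hb
      obtain ⟨hb1, hb2⟩ := Finset.mem_filter.1 hb
      refine ⟨(Tuple.sort f).symm ⟨b, Finset.mem_range.1 hb1⟩, ?_, ?_⟩ <;> simp [f, hb2]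
  rw [hcard] at h1
  rw [orderStat, dif_pos hk]
  refine h1.symm.trans ?_
  simp only
  omega

/-! ### Transfer to the shift on sequence space -/

section Shift

/-- The shift on real sequences. -/
def seqShift (y : ℕ → ℝ) : ℕ → ℝ := fun j => y (1 + j)

theorem measurable_seqShift : Measurable seqShift :=
  measurable_pi_lambda _ fun j => measurable_pi_apply (1 + j)

theorem seqShift_iterate (i : ℕ) (y : ℕ → ℝ) : seqShift^[i] y = fun j => y (i + j) := by
  induction i generalizing y with
  | zero => simp
  | succ i ih =>
    rw [Function.iterate_succ_apply, ih]
    funext j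
    exact congrArg y (by omega)

variable {Ω : Type*} [mΩ : MeasurableSpace Ω] {X : ℕ → Ω → ℝ}

theorem invariantSigmaField_eq_comap (hX : ∀ i, Measurable (X i)) :
    invariantSigmaField X =
      (MeasurableSpace.invariants seqShift).comap (fun ω j => X j ω) := by
  have hXm : Measurable fun ω j => X j ω := measurable_pi_lambda _ hX
  ext A
  constructor
  · rintro ⟨-, B, hB, h⟩
    -- `B` itself need not be shift-invariant. The set of sequences with infinitely many shifts in
    -- `B` is, and it has the same preimage `A`.
    refine ⟨{y | ∃ᶠ i in atTop, seqShift^[i] y ∈ B}, ⟨?_, ?_⟩, ?_⟩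
    · have : {y | ∃ᶠ i in atTop, seqShift^[i] y ∈ B}
          = limsup (fun i => seqShift^[i] ⁻¹' B) atTop := by
        ext y
        rw [mem_limsup_iff_frequently_mem]
        rfl
      rw [this]
      exact MeasurableSet.measurableSet_limsup fun i => measurable_seqShift.iterate i hB
    · ext y
      simp only [Set.preimage_ofPred_eq, Set.mem_ofPred_eq, ← Function.iterate_succ_apply]
      conv_rhs => rw [← map_add_atTop_eq_nat 1, frequently_map]
    · ext ω
      have : ∀ i, seqShift^[i] (fun j => X j ω) ∈ B ↔ ω ∈ A := fun i => by
        rw [seqShift_iterate]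
        exact (Set.ext_iff.1 (h i) ω).symm
      simp [this]
  · rintro ⟨B, ⟨hB, hTB⟩, rfl⟩
    refine ⟨hXm hB, B, hB, fun i => ?_⟩
    ext ω
    have hi : seqShift^[i] ⁻¹' B = B := (MeasurableSpace.le_invariants_iterate _ i B ⟨hB, hTB⟩).2
    have := Set.ext_iff.1 hi (fun j => X j ω)
    rw [Set.mem_preimage, seqShift_iterate] at this
    exact this.symm

/-- The empirical frequencies of a stationary sequence converge almost surely to the conditional
probabilities given the invariant sigma-field. -/
theorem StrictlyStationary.ae_tendsto_frequency {μ : Measure Ω} [IsProbabilityMeasure μ]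
    (hX : ∀ i, Measurable (X i)) (hstat : StrictlyStationary X μ) (t : ℝ) :
    ∀ᵐ ω ∂μ, Tendsto
      (fun n : ℕ => (Finset.card {i ∈ Finset.range n | X i ω ≤ t} : ℝ) / n) atTop
      (𝓝 ((μ⟦{ω' | X 0 ω' ≤ t}|invariantSigmaField X⟧) ω)) := by
  have hXm : Measurable fun ω j => X j ω := measurable_pi_lambda _ hX
  set c := μ⟦{ω' | X 0 ω' ≤ t}|invariantSigmaField X⟧ with hc
  have hcm : StronglyMeasurable[invariantSigmaField X] c := stronglyMeasurable_condExp
  have hcm' := hcm.measurable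
  rw [invariantSigmaField_eq_comap hX] at hcm'
  -- The conditional probability factors through the sequence as an invariant function `H`, the
  -- candidate for the Birkhoff limit.
  obtain ⟨H, hH, hcH⟩ :=
    Measurable.exists_eq_measurable_comp (mY := MeasurableSpace.invariants seqShift) hcm'
  have hHm : Measurable H := hH.mono (MeasurableSpace.invariants_le _) le_rfl
  set φ : (ℕ → ℝ) → ℝ := {y | y 0 ≤ t}.indicator fun _ => 1
  have hs : MeasurableSet {y : ℕ → ℝ | y 0 ≤ t} :=
    measurableSet_le (measurable_pi_apply 0) measurable_const
  have hφm : Measurable φ := measurable_const.indicator hs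
  set ν := μ.map fun ω j => X j ω
  have : IsProbabilityMeasure ν := Measure.isProbabilityMeasure_map hXm.aemeasurable
  have hT : MeasurePreserving seqShift ν ν := by
    refine ⟨measurable_seqShift, ?_⟩
    rw [Measure.map_map measurable_seqShift hXm]
    exact hstat 1
  have hφ : Integrable φ ν := (integrable_const _).indicator hs
  have hHi : Integrable H ν := by
    rw [integrable_map_measure hHm.aestronglyMeasurable hXm.aemeasurable, ← hcH]
    exact integrable_condExp
  have key := hT.ae_tendsto_birkhoffSum_div hφm hφ hHm hHi
    (MeasurableSpace.comp_eq_of_measurable_invariants hH) fun A hA hTA => by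
      rw [setIntegral_map hA hφm.aestronglyMeasurable hXm.aemeasurable,
        setIntegral_map hA hHm.aestronglyMeasurable hXm.aemeasurable]
      have hA' : MeasurableSet[invariantSigmaField X] ((fun ω j => X j ω) ⁻¹' A) := by
        rw [invariantSigmaField_eq_comap hX]
        exact ⟨A, ⟨hA, hTA⟩, rfl⟩
      have hint : Integrable ({ω' | X 0 ω' ≤ t}.indicator fun _ => (1 : ℝ)) μ :=
        (integrable_const _).indicator (measurableSet_le (hX 0) measurable_const)
      have := setIntegral_condExp (invariantSigmaField_le X) hint hA'
      rw [← hc, hcH] at this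
      exact this.symm
  filter_upwards [ae_of_ae_map hXm.aemeasurable key] with ω hω
  rw [hcH]
  refine hω.congr fun n => ?_
  congr 1
  simp [birkhoffSum, seqShift_iterate, φ, Set.indicator_apply]

end Shift

/-! ### Extreme quantiles of a distribution function -/

section Quantile

variable {p : ℝ}

/-- The smallest `p`-quantile of a distribution function. -/
noncomputable def lowerQuantile (F : ℝ → ℝ) (p : ℝ) : ℝ := sInf {x | p ≤ F x}

/-- The largest `p`-quantile of a distribution function. -/
noncomputable def upperQuantile (F : ℝ → ℝ) (p : ℝ) : ℝ := sInf {x | p < F x}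

variable (μ : Measure ℝ)

/-- Right continuity puts the infimum in the set; `0 < p < 1` makes the set nonempty and bounded
below, so `sInf` is genuine. -/
theorem lowerQuantile_cdf_le_iff (hp0 : 0 < p) (hp1 : p < 1) (x : ℝ) :
    lowerQuantile (cdf μ) p ≤ x ↔ p ≤ cdf μ x := by
  obtain ⟨a, ha⟩ := ((tendsto_cdf_atBot μ).eventually_lt_const hp0).exists
  obtain ⟨b, hb⟩ := ((tendsto_cdf_atTop μ).eventually_const_lt hp1).exists
  have hbdd : BddBelow {x | p ≤ cdf μ x} :=
    ⟨a, fun y hy => (monotone_cdf μ).reflect_lt (ha.trans_le hy) |>.le⟩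
  refine ⟨fun h => ?_, fun h => csInf_le hbdd h⟩
  have hr : ContinuousWithinAt (cdf μ) (Set.Ioi x) x :=
    ((cdf μ).right_continuous x).mono Set.Ioi_subset_Ici_self
  refine ge_of_tendsto hr (eventually_mem_nhdsWithin.mono fun y hy => ?_)
  obtain ⟨z, hz, hzy⟩ := (csInf_lt_iff hbdd ⟨b, hb.le⟩).1 (h.trans_lt hy)
  exact le_trans hz (monotone_cdf μ hzy.le)

/-- Monotonicity allows a rational witness, so measurability in `ω` reduces to a countable union. -/
theorem upperQuantile_cdf_lt_iff (hp0 : 0 < p) (hp1 : p < 1) (x : ℝ) :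
    upperQuantile (cdf μ) p < x ↔ ∃ r : ℚ, (r : ℝ) < x ∧ p < cdf μ r := by
  obtain ⟨a, ha⟩ := ((tendsto_cdf_atBot μ).eventually_lt_const hp0).exists
  obtain ⟨b, hb⟩ := ((tendsto_cdf_atTop μ).eventually_const_lt hp1).exists
  have hbdd : BddBelow {x | p < cdf μ x} :=
    ⟨a, fun y hy => (monotone_cdf μ).reflect_lt (ha.trans hy) |>.le⟩
  constructor
  · intro h
    obtain ⟨z, hz, hzx⟩ := (csInf_lt_iff hbdd ⟨b, hb⟩).1 h
    obtain ⟨r, hr1, hr2⟩ := exists_rat_btwn hzx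
    exact ⟨r, hr2, lt_of_lt_of_le hz (monotone_cdf μ hr1.le)⟩
  · rintro ⟨r, hr, h⟩
    exact (csInf_le hbdd h).trans_lt hr

theorem cdf_lt_of_lt_lowerQuantile (hp0 : 0 < p) (hp1 : p < 1) {x : ℝ}
    (hx : x < lowerQuantile (cdf μ) p) : cdf μ x < p :=
  not_le.1 fun h => hx.not_ge ((lowerQuantile_cdf_le_iff μ hp0 hp1 x).2 h)

theorem le_cdf_of_lowerQuantile_le (hp0 : 0 < p) (hp1 : p < 1) {x : ℝ}
    (hx : lowerQuantile (cdf μ) p ≤ x) : p ≤ cdf μ x :=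
  (lowerQuantile_cdf_le_iff μ hp0 hp1 x).1 hx

theorem cdf_le_of_lt_upperQuantile (hp0 : 0 < p) (hp1 : p < 1) {x : ℝ}
    (hx : x < upperQuantile (cdf μ) p) : cdf μ x ≤ p := by
  by_contra! h
  obtain ⟨r, hxr, hr⟩ := exists_rat_btwn hx
  exact lt_irrefl _ ((upperQuantile_cdf_lt_iff μ hp0 hp1 _).2
    ⟨r, hr, h.trans_le (monotone_cdf μ hxr.le)⟩)

theorem lt_cdf_of_upperQuantile_lt (hp0 : 0 < p) (hp1 : p < 1) {x : ℝ}
    (hx : upperQuantile (cdf μ) p < x) : p < cdf μ x := by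
  obtain ⟨r, hr, h⟩ := (upperQuantile_cdf_lt_iff μ hp0 hp1 x).1 hx
  exact h.trans_le (monotone_cdf μ hr.le)

/-- A point at which the distribution function crosses the level `p` is a `p`-quantile. -/
theorem quantile_of_cdf [IsProbabilityMeasure μ] {q : ℝ} (hlow : ∀ x < q, cdf μ x ≤ p)
    (hup : ∀ x, q < x → p ≤ cdf μ x) :
    1 - p ≤ μ.real (Set.Ici q) ∧ p ≤ μ.real (Set.Iic q) := by
  constructor
  · have h1 : μ.real (Set.Iio q) ≤ p := by
      have hp : 0 ≤ p := (cdf_nonneg μ _).trans (hlow (q - 1) (by linarith))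
      have h := (cdf μ).measure_Iio (tendsto_cdf_atBot μ) q
      rw [measure_cdf, sub_zero] at h
      rw [measureReal_def, h]
      refine ENNReal.toReal_le_of_le_ofReal hp (ENNReal.ofReal_le_ofReal ?_)
      exact le_of_tendsto ((monotone_cdf μ).tendsto_leftLim q)
        (eventually_mem_nhdsWithin.mono fun y hy => hlow y hy)
    rw [← Set.compl_Iio, probReal_compl_eq_one_sub measurableSet_Iio]
    linarith
  · rw [← cdf_eq_real]
    have hr : ContinuousWithinAt (cdf μ) (Set.Ioi q) q :=
      ((cdf μ).right_continuous q).mono Set.Ioi_subset_Ici_self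
    exact ge_of_tendsto hr (eventually_mem_nhdsWithin.mono fun y hy => hup y hy)

end Quantile

/-! ### Regular conditional distributions -/

section CondQuantile

variable {Ω : Type*}

/-- The kernel is the conditional distribution of `Y` given the identity into `(Ω, G)`. Product sets
`S` are needed because `Y` is compared with a random level `Q`. -/
theorem exists_condDistrib_kernel {G : MeasurableSpace Ω} [mΩ : MeasurableSpace Ω] (hG : G ≤ mΩ)
    (μ : Measure Ω) [IsProbabilityMeasure μ] {Y : Ω → ℝ} (hY : Measurable Y) :
    ∃ κ : @Kernel Ω ℝ G _, (∀ ω, IsProbabilityMeasure (κ ω)) ∧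
      (∀ x, Measurable[G] fun ω => cdf (κ ω) x) ∧
      ∀ S : Set (Ω × ℝ), MeasurableSet[@Prod.instMeasurableSpace Ω ℝ G _] S →
        μ⟦{ω | (ω, Y ω) ∈ S}|G⟧ =ᵐ[μ] fun ω => (κ ω).real {y | (ω, y) ∈ S} := by
  have hid : @Measurable Ω Ω mΩ G id := measurable_id'' hG
  have hκ : ∀ ω, IsProbabilityMeasure (@condDistrib Ω Ω ℝ _ _ _ mΩ G Y id μ _ ω) := fun ω =>
    inferInstance
  refine ⟨@condDistrib Ω Ω ℝ _ _ _ mΩ G Y id μ _, hκ, fun x => ?_, fun S hS => ?_⟩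
  · simp only [cdf_eq_real]
    exact (Kernel.measurable_coe _ measurableSet_Iic).ennreal_toReal
  · have hS' : MeasurableSet {ω | (ω, Y ω) ∈ S} :=
      (hid.prodMk hY) hS
    have := condExp_prod_ae_eq_integral_condDistrib (μ := μ) (mβ := G) (X := id) (Y := Y)
      (f := S.indicator fun _ => (1 : ℝ)) hid hY.aemeasurable
      ((Measurable.indicator measurable_const hS).stronglyMeasurable)
      ((integrable_const (1 : ℝ)).indicator hS')
    rw [MeasurableSpace.comap_id] at this
    refine EventuallyEq.trans ?_ (this.trans ?_)
    · rfl
    · refine Eventually.of_forall fun ω => ?_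
      have hSω : MeasurableSet {y | (ω, y) ∈ S} := (@measurable_prodMk_left _ _ G _ ω) hS
      exact integral_indicator_one hSω

end CondQuantile

/-! ### Deterministic squeeze -/

section Convergence

theorem tendsto_orderStat {x : ℕ → ℝ} {k : ℕ → ℕ} {p q : ℝ}
    (hk : ∀ n, 1 ≤ n → 1 ≤ k n ∧ k n ≤ n)
    (hlim : Tendsto (fun n => (k n : ℝ) / (n : ℝ)) atTop (𝓝 p)) {c : ℚ → ℝ}
    (hc : ∀ r : ℚ, Tendsto
      (fun n : ℕ => (Finset.card {i ∈ Finset.range n | x i ≤ r} : ℝ) / n) atTop (𝓝 (c r)))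
    (hlow : ∀ r : ℚ, (r : ℝ) < q → c r < p) (hup : ∀ r : ℚ, q < r → p < c r) :
    Tendsto (fun n => orderStat x (k n) n) atTop (𝓝 q) := by
  rw [tendsto_order]
  constructor
  · intro a ha
    obtain ⟨r, har, hrq⟩ := exists_rat_btwn ha
    filter_upwards [(hc r).eventually_lt hlim (hlow r hrq), eventually_ge_atTop 1] with n hn hn1
    refine har.trans (not_le.1 fun h => ?_)
    rw [orderStat_le_iff x (hk n hn1)] at h
    exact hn.not_ge (by gcongr)
  · intro a ha
    obtain ⟨r, hqr, hra⟩ := exists_rat_btwn ha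
    filter_upwards [hlim.eventually_lt (hc r) (hup r hqr), eventually_ge_atTop 1] with n hn hn1
    refine lt_of_le_of_lt ((orderStat_le_iff x (hk n hn1) r).2 ?_) hra
    have hn0 : (0 : ℝ) < n := by exact_mod_cast hn1
    exact_mod_cast ((div_lt_div_iff_of_pos_right hn0).1 hn).le

end Convergence

/-! ### Extreme quantiles as versions, and the conclusion -/

section CondQuantile

variable {Ω : Type*}

theorem measurable_lowerQuantile_cdf {G : MeasurableSpace Ω} {κ : Ω → Measure ℝ} {p : ℝ}
    (hκ : ∀ x, Measurable fun ω => cdf (κ ω) x) (hp0 : 0 < p) (hp1 : p < 1) :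
    Measurable fun ω => lowerQuantile (cdf (κ ω)) p := by
  refine measurable_of_Iic fun x => ?_
  simp only [Set.preimage, Set.mem_Iic, lowerQuantile_cdf_le_iff _ hp0 hp1]
  exact measurableSet_le measurable_const (hκ x)

theorem measurable_upperQuantile_cdf {G : MeasurableSpace Ω} {κ : Ω → Measure ℝ} {p : ℝ}
    (hκ : ∀ x, Measurable fun ω => cdf (κ ω) x) (hp0 : 0 < p) (hp1 : p < 1) :
    Measurable fun ω => upperQuantile (cdf (κ ω)) p := by
  refine measurable_of_Iio fun x => ?_
  simp only [Set.preimage, Set.mem_Iio, upperQuantile_cdf_lt_iff _ hp0 hp1, Set.ofPred_exists]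
  refine MeasurableSet.iUnion fun r => ?_
  exact (MeasurableSet.const _).inter (measurableSet_lt measurable_const (hκ r))

/-- A measurable selection of quantiles of the conditional distributions is a conditional
quantile. -/
theorem isCondQuantile_of_cdf {G : MeasurableSpace Ω} [mΩ : MeasurableSpace Ω]
    {μ : Measure Ω} {Y : Ω → ℝ} {p : ℝ} {κ : Ω → Measure ℝ} [∀ ω, IsProbabilityMeasure (κ ω)]
    (hκ : ∀ S : Set (Ω × ℝ), MeasurableSet[@Prod.instMeasurableSpace Ω ℝ G _] S →
        μ⟦{ω | (ω, Y ω) ∈ S}|G⟧ =ᵐ[μ] fun ω => (κ ω).real {y | (ω, y) ∈ S})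
    {Q : Ω → ℝ} (hQ : Measurable[G] Q) (hlow : ∀ ω, ∀ x < Q ω, cdf (κ ω) x ≤ p)
    (hup : ∀ ω x, Q ω < x → p ≤ cdf (κ ω) x) : IsCondQuantile G μ Y p Q := by
  have hQ' : @Measurable _ _ (@Prod.instMeasurableSpace Ω ℝ G _) _ fun z : Ω × ℝ => Q z.1 :=
    @Measurable.comp _ _ _ (@Prod.instMeasurableSpace Ω ℝ G _) G _ _ _ hQ
      (@measurable_fst _ _ G _)
  have hsnd : @Measurable _ _ (@Prod.instMeasurableSpace Ω ℝ G _) _ fun z : Ω × ℝ => z.2 :=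
    @measurable_snd _ _ G _
  refine ⟨hQ, ?_, ?_⟩
  · filter_upwards [hκ {z | Q z.1 ≤ z.2} (measurableSet_le hQ' hsnd)] with ω hω
    exact (quantile_of_cdf (κ ω) (hlow ω) (hup ω)).1.trans_eq hω.symm
  · filter_upwards [hκ {z | z.2 ≤ Q z.1} (measurableSet_le hsnd hQ')] with ω hω
    exact (quantile_of_cdf (κ ω) (hlow ω) (hup ω)).2.trans_eq hω.symm

end CondQuantile

theorem mainTheorem1 {Ω : Type*} [MeasurableSpace Ω] (μ : Measure Ω) [IsProbabilityMeasure μ]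
    (X : ℕ → Ω → ℝ) (hX : ∀ i, Measurable (X i)) (hstat : StrictlyStationary X μ)
    (p : ℝ) (hp0 : 0 < p) (hp1 : p < 1)
    (k : ℕ → ℕ) (hk : ∀ n, 1 ≤ n → 1 ≤ k n ∧ k n ≤ n)
    (hlim : Tendsto (fun n => (k n : ℝ) / (n : ℝ)) atTop (𝓝 p))
    (huniq : CondQuantileUnique (invariantSigmaField X) μ (X 0) p) :
    (∃ Q : Ω → ℝ, IsCondQuantile (invariantSigmaField X) μ (X 0) p Q) ∧
    ∀ Q : Ω → ℝ, IsCondQuantile (invariantSigmaField X) μ (X 0) p Q →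
      ∀ᵐ ω ∂μ, Tendsto (fun n => orderStat (fun i => X i ω) (k n) n) atTop (𝓝 (Q ω)) := by
  obtain ⟨κ, hκp, hκm, hκ⟩ := exists_condDistrib_kernel (invariantSigmaField_le X) μ (hX 0)
  have hl : IsCondQuantile (invariantSigmaField X) μ (X 0) p
      fun ω => lowerQuantile (cdf (κ ω)) p :=
    isCondQuantile_of_cdf hκ (measurable_lowerQuantile_cdf hκm hp0 hp1)
      (fun ω x hx => (cdf_lt_of_lt_lowerQuantile _ hp0 hp1 hx).le)
      (fun ω x hx => le_cdf_of_lowerQuantile_le _ hp0 hp1 hx.le)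
  have hu : IsCondQuantile (invariantSigmaField X) μ (X 0) p
      fun ω => upperQuantile (cdf (κ ω)) p :=
    isCondQuantile_of_cdf hκ (measurable_upperQuantile_cdf hκm hp0 hp1)
      (fun ω x hx => cdf_le_of_lt_upperQuantile _ hp0 hp1 hx)
      (fun ω x hx => (lt_cdf_of_upperQuantile_lt _ hp0 hp1 hx).le)
  refine ⟨⟨_, hl⟩, fun Q hQ => ?_⟩
  have hfreq := ae_all_iff.2 fun r : ℚ => hstat.ae_tendsto_frequency hX (r : ℝ)
  have hcdf := ae_all_iff.2 fun r : ℚ =>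
    hκ {z | z.2 ≤ (r : ℝ)} (measurableSet_le (@measurable_snd Ω ℝ (invariantSigmaField X) _)
      (@measurable_const _ _ _ (@Prod.instMeasurableSpace Ω ℝ (invariantSigmaField X) _) _))
  filter_upwards [hfreq, hcdf, huniq _ _ hQ hl, huniq _ _ hQ hu] with ω hf hF hQl hQu
  have hF' : ∀ r : ℚ, (μ⟦{ω' | X 0 ω' ≤ r}|invariantSigmaField X⟧) ω = cdf (κ ω) r := fun r =>
    (hF r).trans (cdf_eq_real (κ ω) r).symm
  -- Strictness below `Q` comes from the lower quantile and strictness above from the upper one;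
  -- this is where uniqueness enters.
  refine tendsto_orderStat hk hlim (c := fun r => cdf (κ ω) r) (fun r => ?_)
    (fun r hr => cdf_lt_of_lt_lowerQuantile _ hp0 hp1 (hQl ▸ hr))
    (fun r hr => lt_cdf_of_upperQuantile_lt _ hp0 hp1 (hQu ▸ hr))
  rw [← hF' r]
  exact hf r
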